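/- An ordered graph on $n$ vertices is a simple graph together with a linear order on its (finite) vertex set, which is identified, respecting the order, with $[n]=\{1,\dots,n\}$. A hereditary property of ordered graphs is a collection $\mathcal{P}$ of ordered graphs that is closed under taking induced ordered subgraphs (with the inherited order, again relabelled order-preservingly by an initial segment of $\mathbb{N}$). Write $\mathcal{P}_n$ for the set of ordered graphs in $\mathcal{P}$ with vertex set $[n]$. Theorem. Let $\mathcal{P}$ be a hereditary property of ordered graphs. If $|\mathcal{P}_k| < k$ for some $k \geqslant 136$, then $|\mathcal{P}_n| \leqslant |\mathcal{P}_k|$ for every $n \geqslant k$. Moreover, the function $n \mapsto |\mathcal{P}_n|$ is non-increasing on $\{k, k+1, \dots\}$, that is, $|\mathcal{P}_n| \leqslant |\mathcal{P}_m|$ whenever $n \geqslant m \geqslant k$. -/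

import Mathlib

/-- A (finite) ordered graph: a simple graph whose linearly ordered vertex set is identified, by the
unique order isomorphism, with `Fin n`, where `n` is the number of vertices. -/
structure OrderedGraph where
  /-- the number of vertices -/
  order : ℕ
  /-- the graph on the vertex set `Fin order`, which carries its usual linear order -/
  graph : SimpleGraph (Fin order)

namespace OrderedGraph

/-- `H` is (after the order-preserving identification of its vertex set with an initial segment of
the natural numbers) an induced ordered subgraph of `G`. -/
def IsInducedSubgraph (H G : OrderedGraph) : Prop :=
  ∃ f : Fin H.order ↪o Fin G.order, ∀ u v, H.graph.Adj u v ↔ G.graph.Adj (f u) (f v)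

/-- A collection of ordered graphs is hereditary if it is closed under taking induced ordered
subgraphs. -/
def IsHereditary (P : Set OrderedGraph) : Prop :=
  ∀ ⦃G H : OrderedGraph⦄, G ∈ P → H.IsInducedSubgraph G → H ∈ P

/-- The collection of those graphs on the vertex set `Fin n` that belong to `P`. -/
def level (P : Set OrderedGraph) (n : ℕ) : Set (SimpleGraph (Fin n)) :=
  {G | (⟨n, G⟩ : OrderedGraph) ∈ P}

/-- The speed of `P`: the number of members of `P` with vertex set `Fin n`. -/
noncomputable def speed (P : Set OrderedGraph) (n : ℕ) : ℕ :=
  (level P n).ncard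

end OrderedGraph

/-! The heart is `card_le_card_deletions`: at most `k` graphs on `k + 1` vertices have at least as
many vertex-deleted subgraphs as there are graphs. Heredity puts these subgraphs in `P`, so `speed P
k + 1` members on `k + 1` vertices are impossible.

The induction on vertices needs forbidden deletions, each adding one to a graph's weight. Restrict
`F` to its initial vertices, giving `X`, and also forbid on `K ∈ X` the vertices that identify two
extensions of `K`. By Bondy's theorem these are fewer than the extensions, so total weight does not
grow. A Hall matching of `X` into its deletions lifts to `F`.

If Hall fails, the weight is exactly critical, and only `X` itself violates Hall, by one. Then all
fibres have equal size, and deleting a collapsing vertex always gives one and the same graph. At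
least `X.card` vertices `p` are forbidden nowhere; each yields two members of `X` differing in a
single pair at `p`, which contradicts Bondy's theorem for edges. -/

open Classical in
/-- Bondy's theorem: if each coordinate in `S` is the only coordinate at which some two members of
`W` differ, then `S` has fewer elements than `W`. -/
theorem card_lt_card_of_differ_at {ι : Type*} (W : Finset (ι → Prop)) (S : Finset ι)
    (hW : W.Nonempty)
    (h : ∀ s ∈ S, ∃ w ∈ W, ∃ w' ∈ W, w ≠ w' ∧ ∀ i, i ≠ s → w i = w' i) :
    S.card < W.card := by
  induction S using Finset.induction_on generalizing W with
  | empty => simpa using hW.card_pos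
  | insert b S hb ih =>
    rw [Finset.card_insert_of_notMem hb]
    -- Erasing coordinate `b` merges two members of `W`, while the pairs for the other coordinates
    -- survive.
    let π : (ι → Prop) → (ι → Prop) := fun w => Function.update w b False
    have hlt : (W.image π).card < W.card := by
      refine lt_of_le_of_ne Finset.card_image_le fun heq => ?_
      obtain ⟨w, hw, w', hw', hne, hag⟩ := h b (Finset.mem_insert_self _ _)
      refine hne (Finset.card_image_iff.1 heq hw hw' ?_)
      funext i
      by_cases hi : i = b
      · subst hi; simp [π]
      · simp [π, hi, hag i hi]
    have := ih (W.image π) (hW.image _) fun s hs => by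
      obtain ⟨w, hw, w', hw', hne, hag⟩ := h s (Finset.mem_insert_of_mem hs)
      have hsb : s ≠ b := fun e => hb (e ▸ hs)
      refine ⟨π w, Finset.mem_image_of_mem _ hw, π w', Finset.mem_image_of_mem _ hw', ?_, ?_⟩
      · intro e
        apply hne
        funext i
        by_cases hi : i = s
        · subst hi
          simpa [π, hsb] using congrFun e i
        · exact hag i hi
      · intro i hi
        by_cases hib : i = b
        · subst hib; simp [π]
        · simp [π, hib, hag i hi]
    omega

/-! ### Vertex deletion and the last row -/

namespace SimpleGraph

/-- Delete the vertex `v` and relabel the remaining vertices in increasing order. -/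
def deleteAt {n : ℕ} (G : SimpleGraph (Fin (n + 1))) (v : Fin (n + 1)) : SimpleGraph (Fin n) :=
  G.comap v.succAbove

/-- The adjacencies of the last vertex. -/
def lastRow {n : ℕ} (G : SimpleGraph (Fin (n + 1))) (x : Fin n) : Prop :=
  G.Adj x.castSucc (Fin.last n)

theorem deleteAt_adj {n : ℕ} (G : SimpleGraph (Fin (n + 1))) (v : Fin (n + 1)) (x y : Fin n) :
    (G.deleteAt v).Adj x y ↔ G.Adj (v.succAbove x) (v.succAbove y) := Iff.rfl

theorem adj_iff_of_deleteAt_eq {n : ℕ} {G H : SimpleGraph (Fin (n + 1))} {v : Fin (n + 1)}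
    (h : G.deleteAt v = H.deleteAt v) {x y : Fin (n + 1)} (hx : x ≠ v) (hy : y ≠ v) :
    G.Adj x y ↔ H.Adj x y := by
  obtain ⟨x, rfl⟩ := Fin.exists_succAbove_eq hx
  obtain ⟨y, rfl⟩ := Fin.exists_succAbove_eq hy
  rw [← deleteAt_adj, h, deleteAt_adj]

theorem ext_of_deleteAt_last {n : ℕ} {G H : SimpleGraph (Fin (n + 1))}
    (h : G.deleteAt (Fin.last n) = H.deleteAt (Fin.last n)) (hr : G.lastRow = H.lastRow) :
    G = H := by
  ext x y
  induction x using Fin.lastCases with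
  | last =>
    induction y using Fin.lastCases with
    | last => simp
    | cast y => rw [G.adj_comm, H.adj_comm]; exact iff_of_eq (congrFun hr y)
  | cast x =>
    induction y using Fin.lastCases with
    | last => exact iff_of_eq (congrFun hr x)
    | cast y => exact adj_iff_of_deleteAt_eq h (Fin.castSucc_ne_last x) (Fin.castSucc_ne_last y)

theorem deleteAt_castSucc_deleteAt_last {n : ℕ} (G : SimpleGraph (Fin (n + 2))) (u : Fin (n + 1)) :
    (G.deleteAt u.castSucc).deleteAt (Fin.last n) = (G.deleteAt (Fin.last (n + 1))).deleteAt u := by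
  ext x y
  simp [deleteAt_adj]

theorem lastRow_deleteAt_castSucc {n : ℕ} (G : SimpleGraph (Fin (n + 2))) (u : Fin (n + 1))
    (x : Fin n) : (G.deleteAt u.castSucc).lastRow x = G.lastRow (u.succAbove x) := by
  simp [lastRow, deleteAt_adj]

theorem lastRow_eq_of_deleteAt_eq {n : ℕ} {G H : SimpleGraph (Fin (n + 1))} {u : Fin n}
    (h : G.deleteAt u.castSucc = H.deleteAt u.castSucc) {i : Fin n} (hi : i ≠ u) :
    G.lastRow i = H.lastRow i :=
  propext (adj_iff_of_deleteAt_eq h (fun e => hi (Fin.castSucc_injective _ e))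
    (Fin.castSucc_ne_last u).symm)

open Classical in
theorem card_lt_card_of_lastRow_differ_at {n : ℕ} (F : Finset (SimpleGraph (Fin (n + 1))))
    (L : SimpleGraph (Fin n)) (hL : ∀ G ∈ F, G.deleteAt (Fin.last n) = L) (hF : F.Nonempty)
    (S : Finset (Fin n))
    (h : ∀ s ∈ S, ∃ G ∈ F, ∃ H ∈ F, G ≠ H ∧ ∀ i, i ≠ s → G.lastRow i = H.lastRow i) :
    S.card < F.card := by
  refine lt_of_lt_of_le (card_lt_card_of_differ_at (F.image lastRow) S (hF.image _) ?_)
    Finset.card_image_le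
  intro s hs
  obtain ⟨G, hG, H, hH, hne, hag⟩ := h s hs
  exact ⟨_, Finset.mem_image_of_mem _ hG, _, Finset.mem_image_of_mem _ hH,
    fun e => hne (ext_of_deleteAt_last ((hL G hG).trans (hL H hH).symm) e), hag⟩

/-! ### Matching graphs with their deletions -/

open Classical in
/-- The vertex-deleted subgraphs of the members of `F`, where from `G` no vertex of `B G` may be
deleted. -/
noncomputable def deletions {n : ℕ} (F : Finset (SimpleGraph (Fin (n + 1))))
    (B : SimpleGraph (Fin (n + 1)) → Finset (Fin (n + 1))) : Finset (SimpleGraph (Fin n)) :=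
  F.biUnion fun G => (B G)ᶜ.image G.deleteAt

theorem mem_deletions {n : ℕ} {F : Finset (SimpleGraph (Fin (n + 1)))}
    {B : SimpleGraph (Fin (n + 1)) → Finset (Fin (n + 1))} {S : SimpleGraph (Fin n)} :
    S ∈ deletions F B ↔ ∃ G ∈ F, ∃ v ∉ B G, G.deleteAt v = S := by
  simp [deletions]

/-- Hall's marriage theorem, each graph choosing among its allowed deletions. -/
theorem exists_injOn_deleteAt {n : ℕ} (F : Finset (SimpleGraph (Fin (n + 1))))
    (B : SimpleGraph (Fin (n + 1)) → Finset (Fin (n + 1)))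
    (h : ∀ F' ⊆ F, F'.card ≤ (deletions F' B).card) :
    ∃ v : SimpleGraph (Fin (n + 1)) → Fin (n + 1),
      (∀ G ∈ F, v G ∉ B G) ∧ Set.InjOn (fun G : SimpleGraph (Fin (n + 1)) => G.deleteAt (v G)) F := by
  classical
  obtain ⟨f, hf, hm⟩ := (Finset.all_card_le_biUnion_card_iff_exists_injective
    (fun G : F => (B G)ᶜ.image (G : SimpleGraph (Fin (n + 1))).deleteAt)).1 fun s => by
      have := h (s.image Subtype.val) (by intro x hx; simp at hx; exact hx.1)
      rw [Finset.card_image_of_injective _ Subtype.val_injective, deletions,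
        Finset.image_biUnion] at this
      exact this
  have : ∀ G : F, ∃ v ∉ B G, (G : SimpleGraph (Fin (n + 1))).deleteAt v = f G := fun G => by
    simpa using hm G
  choose v hv hvf using this
  refine ⟨fun G => if hG : G ∈ F then v ⟨G, hG⟩ else 0, fun G hG => ?_, fun G hG H hH e => ?_⟩
  · simpa [hG] using hv ⟨G, hG⟩
  · have hG' : G ∈ F := hG
    have hH' : H ∈ F := hH
    simp only [hG', hH', dif_pos] at e
    rw [hvf ⟨G, hG⟩, hvf ⟨H, hH⟩] at e
    exact congrArg Subtype.val (hf e)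

/-! ### Fibres of the restriction to the initial vertices -/

section Fibres

open Classical

variable {n : ℕ} (F : Finset (SimpleGraph (Fin (n + 2))))
  (B : SimpleGraph (Fin (n + 2)) → Finset (Fin (n + 2))) (K : SimpleGraph (Fin (n + 1)))

/-- The members of `F` that extend `K` by a last vertex. -/
noncomputable def lastFibre : Finset (SimpleGraph (Fin (n + 2))) :=
  F.filter fun G => G.deleteAt (Fin.last (n + 1)) = K

/-- The vertices whose deletion identifies two extensions of `K` in `F`. -/
noncomputable def collapsing : Finset (Fin (n + 1)) :=
  Finset.univ.filter fun u => ∃ G ∈ lastFibre F K, ∃ H ∈ lastFibre F K,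
    G ≠ H ∧ G.deleteAt u.castSucc = H.deleteAt u.castSucc

/-- The vertices that may not be deleted from `K` if the deletion is to lift to all extensions of
`K` in `F`. -/
noncomputable def inducedForbidden : Finset (Fin (n + 1)) :=
  collapsing F K ∪ (lastFibre F K).biUnion fun G =>
    Finset.univ.filter fun u : Fin (n + 1) => u.castSucc ∈ B G

/-- The allowed vertex-deleted subgraphs of members of `F` that extend `L` by a last vertex. -/
noncomputable def shadowFibre (L : SimpleGraph (Fin n)) : Finset (SimpleGraph (Fin (n + 1))) :=
  (deletions F B).filter fun S => S.deleteAt (Fin.last n) = L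

variable {F B K}

theorem mem_lastFibre {G : SimpleGraph (Fin (n + 2))} :
    G ∈ lastFibre F K ↔ G ∈ F ∧ G.deleteAt (Fin.last (n + 1)) = K := by
  simp [lastFibre]

theorem lastFibre_nonempty (hK : K ∈ F.image fun G => G.deleteAt (Fin.last (n + 1))) :
    (lastFibre F K).Nonempty := by
  obtain ⟨G, hG, rfl⟩ := Finset.mem_image.1 hK
  exact ⟨G, mem_lastFibre.2 ⟨hG, rfl⟩⟩

theorem exists_of_mem_collapsing {u : Fin (n + 1)} (hu : u ∈ collapsing F K) :
    ∃ G ∈ lastFibre F K, ∃ H ∈ lastFibre F K, G ≠ H ∧ ∀ i, i ≠ u → G.lastRow i = H.lastRow i := by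
  obtain ⟨G, hG, H, hH, hne, h⟩ := (Finset.mem_filter.1 hu).2
  exact ⟨G, hG, H, hH, hne, fun i hi => lastRow_eq_of_deleteAt_eq h hi⟩

theorem card_collapsing_lt (hK : (lastFibre F K).Nonempty) :
    (collapsing F K).card < (lastFibre F K).card :=
  card_lt_card_of_lastRow_differ_at _ K (fun _ hG => (mem_lastFibre.1 hG).2) hK _
    fun _ hs => exists_of_mem_collapsing hs

theorem deleteAt_mem_shadowFibre {G : SimpleGraph (Fin (n + 2))} (hG : G ∈ lastFibre F K)
    {u : Fin (n + 1)} (hu : u.castSucc ∉ B G) :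
    G.deleteAt u.castSucc ∈ shadowFibre F B (K.deleteAt u) := by
  obtain ⟨hGF, rfl⟩ := mem_lastFibre.1 hG
  exact Finset.mem_filter.2 ⟨mem_deletions.2 ⟨G, hGF, _, hu, rfl⟩,
    deleteAt_castSucc_deleteAt_last G u⟩

theorem castSucc_notMem_of_notMem_inducedForbidden {u : Fin (n + 1)}
    (hu : u ∉ inducedForbidden F B K) {G : SimpleGraph (Fin (n + 2))} (hG : G ∈ lastFibre F K) :
    u.castSucc ∉ B G := by
  intro h
  exact hu (Finset.mem_union_right _ (Finset.mem_biUnion.2 ⟨G, hG, by simpa using h⟩))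

/-- A vertex that is not collapsing can be deleted injectively from all extensions of `K`. -/
theorem card_lastFibre_le {u : Fin (n + 1)} (hu : u ∉ inducedForbidden F B K) :
    (lastFibre F K).card ≤ (shadowFibre F B (K.deleteAt u)).card := by
  refine Finset.card_le_card_of_injOn (fun G => G.deleteAt u.castSucc)
    (fun G hG => deleteAt_mem_shadowFibre hG
      (castSucc_notMem_of_notMem_inducedForbidden hu hG)) fun G hG H hH e => ?_
  by_contra hne
  exact hu (Finset.mem_union_left _
    (Finset.mem_filter.2 ⟨Finset.mem_univ _, G, hG, H, hH, hne, e⟩))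

/-- The coordinates that collapse two extensions of `K` still do so after deleting `u`. -/
theorem exists_of_succAbove_mem_collapsing {u : Fin (n + 1)}
    (hB : ∀ G ∈ lastFibre F K, u.castSucc ∉ B G) {x : Fin n}
    (hx : u.succAbove x ∈ collapsing F K) :
    ∃ S ∈ shadowFibre F B (K.deleteAt u), ∃ S' ∈ shadowFibre F B (K.deleteAt u),
      S ≠ S' ∧ ∀ i, i ≠ x → S.lastRow i = S'.lastRow i := by
  obtain ⟨G, hG, H, hH, hne, hag⟩ := exists_of_mem_collapsing hx
  refine ⟨_, deleteAt_mem_shadowFibre hG (hB G hG), _, deleteAt_mem_shadowFibre hH (hB H hH),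
    fun e => hne ?_, fun i hi => ?_⟩
  · refine ext_of_deleteAt_last
      ((mem_lastFibre.1 hG).2.trans (mem_lastFibre.1 hH).2.symm) (funext fun i => ?_)
    by_cases hi : i = u.succAbove x
    · rw [hi, ← lastRow_deleteAt_castSucc, e, lastRow_deleteAt_castSucc]
    · exact hag i hi
  · rw [lastRow_deleteAt_castSucc, lastRow_deleteAt_castSucc]
    exact hag _ fun e => hi (Fin.succAbove_right_injective e)

theorem card_filter_succAbove_mem (S : Finset (Fin (n + 1))) (u : Fin (n + 1)) :
    (Finset.univ.filter fun x : Fin n => u.succAbove x ∈ S).card = (S.erase u).card := by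
  rw [← Finset.card_map u.succAboveEmb]
  congr 1
  ext y
  simp only [Finset.mem_map, Finset.mem_filter, Finset.mem_univ, true_and, Finset.mem_erase]
  constructor
  · rintro ⟨x, hx, rfl⟩
    exact ⟨Fin.succAbove_ne u x, hx⟩
  · rintro ⟨hy, hyS⟩
    obtain ⟨x, rfl⟩ := Fin.exists_succAbove_eq hy
    exact ⟨x, hyS, rfl⟩

/-- At most the coordinate `u` itself is lost by deleting `u`; the strict inequality in Bondy's
theorem makes up for it. -/
theorem card_collapsing_le_card_shadowFibre {u : Fin (n + 1)} (hK : (lastFibre F K).Nonempty)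
    (hB : ∀ G ∈ lastFibre F K, u.castSucc ∉ B G) :
    (collapsing F K).card ≤ (shadowFibre F B (K.deleteAt u)).card := by
  obtain ⟨G, hG⟩ := hK
  have h := card_lt_card_of_lastRow_differ_at (shadowFibre F B (K.deleteAt u)) (K.deleteAt u)
    (fun _ hS => (Finset.mem_filter.1 hS).2) ⟨_, deleteAt_mem_shadowFibre hG (hB G hG)⟩
    (Finset.univ.filter fun x : Fin n => u.succAbove x ∈ collapsing F K)
    fun x hx => exists_of_succAbove_mem_collapsing hB (by simpa using hx)
  rw [card_filter_succAbove_mem] at h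
  have := Finset.pred_card_le_card_erase (s := collapsing F K) (a := u)
  omega

theorem sum_card_shadowFibre_le (X : Finset (SimpleGraph (Fin n))) :
    ∑ L ∈ X, (shadowFibre F B L).card ≤ (deletions F B).card := by
  rw [← Finset.card_biUnion]
  · exact Finset.card_le_card (Finset.biUnion_subset.2 fun L _ => Finset.filter_subset _ _)
  · intro L _ L' _ hne
    refine Finset.disjoint_left.2 fun S hS hS' => hne ?_
    rw [← (Finset.mem_filter.1 hS).2, (Finset.mem_filter.1 hS').2]

end Fibres

end SimpleGraph

namespace SimpleGraph

-- A matching of `X` lifts fibre by fibre, since distinct deletions have disjoint shadow fibres.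
open Classical in
theorem sum_card_lastFibre_le {n : ℕ} {F : Finset (SimpleGraph (Fin (n + 2)))}
    {B : SimpleGraph (Fin (n + 2)) → Finset (Fin (n + 2))}
    (X : Finset (SimpleGraph (Fin (n + 1))))
    (h : ∀ Y ⊆ X, Y.card ≤ (deletions Y (inducedForbidden F B)).card) :
    ∑ K ∈ X, (lastFibre F K).card ≤
      ∑ L ∈ deletions X (inducedForbidden F B), (shadowFibre F B L).card := by
  obtain ⟨v, hv, hinj⟩ := exists_injOn_deleteAt X _ h
  calc ∑ K ∈ X, (lastFibre F K).card
      ≤ ∑ K ∈ X, (shadowFibre F B (K.deleteAt (v K))).card :=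
        Finset.sum_le_sum fun K hK => card_lastFibre_le (hv K hK)
    _ = ∑ L ∈ X.image fun K => K.deleteAt (v K), (shadowFibre F B L).card :=
        by
          rw [Finset.sum_image hinj]
    _ ≤ _ := Finset.sum_le_sum_of_subset fun L hL => by
        obtain ⟨K, hK, rfl⟩ := Finset.mem_image.1 hL
        exact mem_deletions.2 ⟨K, hK, _, hv K hK, rfl⟩

/-! ### Weights under restriction, and the case of equality -/

section Weights

open Classical

variable {n : ℕ} {F : Finset (SimpleGraph (Fin (n + 2)))}
  {B : SimpleGraph (Fin (n + 2)) → Finset (Fin (n + 2))} {K : SimpleGraph (Fin (n + 1))}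

theorem card_filter_castSucc_mem (S : Finset (Fin (n + 2))) :
    (Finset.univ.filter fun u : Fin (n + 1) => u.castSucc ∈ S).card =
      (S.erase (Fin.last (n + 1))).card := by
  rw [← card_filter_succAbove_mem]
  simp

theorem one_add_card_inducedForbidden_le (hK : (lastFibre F K).Nonempty) :
    1 + (inducedForbidden F B K).card ≤ ∑ G ∈ lastFibre F K, (1 + (B G).card) := by
  have h1 := card_collapsing_lt hK
  have h2 : (inducedForbidden F B K).card ≤ (collapsing F K).card +
      ∑ G ∈ lastFibre F K, (B G).card := by
    refine (Finset.card_union_le _ _).trans (Nat.add_le_add_left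
      (Finset.card_biUnion_le.trans (Finset.sum_le_sum fun G _ => ?_)) _)
    rw [card_filter_castSucc_mem]
    exact Finset.card_erase_le
  rw [Finset.sum_add_distrib, Finset.sum_const, smul_eq_mul, mul_one]
  omega

/-- Weight would be lost by slack in Bondy's bound, by a collapsing vertex that `B` also forbids, or
by a forbidden last vertex, which the restriction forgets. -/
theorem of_sum_le_one_add_card_inducedForbidden (hK : (lastFibre F K).Nonempty)
    (h : ∑ G ∈ lastFibre F K, (1 + (B G).card) ≤ 1 + (inducedForbidden F B K).card) :
    (collapsing F K).card + 1 = (lastFibre F K).card ∧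
      (∀ u ∈ collapsing F K, ∀ G ∈ lastFibre F K, u.castSucc ∉ B G) ∧
      ∀ G ∈ lastFibre F K, Fin.last (n + 1) ∉ B G := by
  have h1 := card_collapsing_lt hK
  rw [Finset.sum_add_distrib, Finset.sum_const, smul_eq_mul, mul_one] at h
  set R := (lastFibre F K).biUnion fun G =>
    Finset.univ.filter fun u : Fin (n + 1) => u.castSucc ∈ B G with hR
  have h2 : (inducedForbidden F B K).card + (collapsing F K ∩ R).card =
      (collapsing F K).card + R.card := Finset.card_union_add_card_inter _ _
  have h3 : R.card ≤ ∑ G ∈ lastFibre F K, ((B G).erase (Fin.last (n + 1))).card := by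
    refine Finset.card_biUnion_le.trans (le_of_eq (Finset.sum_congr rfl fun G _ => ?_))
    exact card_filter_castSucc_mem _
  have h4 : ∑ G ∈ lastFibre F K, ((B G).erase (Fin.last (n + 1))).card ≤
      ∑ G ∈ lastFibre F K, (B G).card := Finset.sum_le_sum fun G _ => Finset.card_erase_le
  refine ⟨by omega, fun u hu G hG hmem => ?_, fun G hG hmem => ?_⟩
  · have : 0 < (collapsing F K ∩ R).card := Finset.card_pos.2 ⟨u, Finset.mem_inter.2
      ⟨hu, Finset.mem_biUnion.2 ⟨G, hG, by simpa using hmem⟩⟩⟩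
    omega
  · have : ∑ G ∈ lastFibre F K, ((B G).erase (Fin.last (n + 1))).card <
        ∑ G ∈ lastFibre F K, (B G).card :=
      Finset.sum_lt_sum (fun G _ => Finset.card_erase_le)
        ⟨G, hG, Finset.card_erase_lt_of_mem hmem⟩
    omega

end Weights

open Classical in
/-- If each vertex `p` of `U` has a partner `c` outside `U` such that two members of `X` differ
exactly in the pair `p`, `c`, then `U` has fewer elements than `X`. -/
theorem card_lt_card_of_differ_at_edge {V : Type*} (X : Finset (SimpleGraph V)) (hX : X.Nonempty)
    (U : Finset V)
    (h : ∀ p ∈ U, ∃ c ∉ U, ∃ K ∈ X, ∃ K' ∈ X, K ≠ K' ∧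
      ∀ x y, s(x, y) ≠ s(p, c) → (K.Adj x y ↔ K'.Adj x y)) : U.card < X.card := by
  choose! c hc K hK K' hK' hne hag using h
  have hinj : Set.InjOn (fun p => s(p, c p)) U := by
    intro p hp q hq e
    rcases Sym2.eq_iff.1 e with h | h
    · exact h.1
    · exact absurd (h.1 ▸ hp) (hc q hq)
  rw [← Finset.card_image_of_injOn hinj]
  let w : SimpleGraph V → Sym2 V → Prop := fun G e => e ∈ G.edgeSet
  refine lt_of_lt_of_le (card_lt_card_of_differ_at (X.image w) _ (hX.image _) ?_)
    Finset.card_image_le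
  intro s hs
  obtain ⟨p, hp, rfl⟩ := Finset.mem_image.1 hs
  refine ⟨_, Finset.mem_image_of_mem w (hK p hp), _, Finset.mem_image_of_mem w (hK' p hp),
    fun e => hne p hp ?_, fun i hi => ?_⟩
  · ext x y
    exact iff_of_eq (congrFun e s(x, y))
  · induction i using Sym2.ind with
    | _ x y => exact propext (hag p hp x y hi)

/-! ### The induction on the number of vertices -/

open Classical in
/-- A family of graphs on `Fin (n + 1)` whose total weight, a graph with `b` forbidden deletions
having weight `b + 1`, is at most `n` has at least as many allowed vertex-deleted subgraphs as it
has members. -/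
theorem card_le_card_deletions (n : ℕ) (F : Finset (SimpleGraph (Fin (n + 1))))
    (B : SimpleGraph (Fin (n + 1)) → Finset (Fin (n + 1)))
    (h : ∑ G ∈ F, (1 + (B G).card) ≤ n) : F.card ≤ (deletions F B).card := by
  induction n with
  | zero =>
    have : F.card ≤ ∑ G ∈ F, (1 + (B G).card) := by
      rw [Finset.card_eq_sum_ones]; exact Finset.sum_le_sum fun _ _ => Nat.le_add_right _ _
    omega
  | succ n ih =>
    by_contra! hlt
    set X := F.image fun G => G.deleteAt (Fin.last (n + 1)) with hX
    have hmaps : ∀ G ∈ F, G.deleteAt (Fin.last (n + 1)) ∈ X := fun G hG =>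
      Finset.mem_image_of_mem _ hG
    have hne : ∀ K ∈ X, (lastFibre F K).Nonempty := fun K hK => lastFibre_nonempty hK
    have hm : F.card = ∑ K ∈ X, (lastFibre F K).card :=
      Finset.card_eq_sum_card_image _ _
    have hw : ∑ K ∈ X, ∑ G ∈ lastFibre F K, (1 + (B G).card) = ∑ G ∈ F, (1 + (B G).card) :=
      Finset.sum_fiberwise_of_maps_to hmaps _
    have hB' : ∀ K ∈ X, 1 + (inducedForbidden F B K).card ≤
        ∑ G ∈ lastFibre F K, (1 + (B G).card) := fun K hK =>
      one_add_card_inducedForbidden_le (hne K hK)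
    -- no matching of `X` lifts to `F`
    have hno : ¬ ∀ Y ⊆ X, Y.card ≤ (deletions Y (inducedForbidden F B)).card := fun hY => by
      have h1 := sum_card_lastFibre_le X hY
      have h2 := sum_card_shadowFibre_le (F := F) (B := B) (deletions X (inducedForbidden F B))
      omega
    have hsub : ∀ Y ⊆ X, ∑ K ∈ Y, (1 + (inducedForbidden F B K).card) ≤
        ∑ K ∈ X, (1 + (inducedForbidden F B K).card) := fun Y hY =>
      Finset.sum_le_sum_of_subset hY
    have hgt : n < ∑ K ∈ X, (1 + (inducedForbidden F B K).card) := by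
      by_contra! hle
      exact hno fun Y hY => ih Y _ ((hsub Y hY).trans hle)
    have hle := Finset.sum_le_sum hB'
    have heq : ∑ K ∈ X, (1 + (inducedForbidden F B K).card) = n + 1 := by omega
    have htight := (Finset.sum_eq_sum_iff_of_le hB').1 (by omega)
    have ht := fun K hK => of_sum_le_one_add_card_inducedForbidden (hne K hK) (htight K hK).ge
    have hcol := fun K hK => (ht K hK).1
    have hcolB := fun K hK => (ht K hK).2.1
    -- restriction to the initial vertices is not injective
    obtain ⟨K₀, hK₀, hn₀⟩ : ∃ K₀ ∈ X, 1 < (lastFibre F K₀).card := by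
      by_contra! hall
      refine hlt.not_ge (Finset.card_le_card_of_injOn
        (fun G => G.deleteAt (Fin.last (n + 1))) (fun G hG => ?_) fun G hG H hH e => ?_)
      · exact mem_deletions.2 ⟨G, hG, _, (ht _ (hmaps G hG)).2.2 G
          (mem_lastFibre.2 ⟨hG, rfl⟩), rfl⟩
      · exact Finset.card_le_one.1 (hall _ (hmaps G hG)) G (mem_lastFibre.2 ⟨hG, rfl⟩) H
          (mem_lastFibre.2 ⟨hH, e.symm⟩)
    have hproper : ∀ Y ⊂ X, Y.card ≤ (deletions Y (inducedForbidden F B)).card := fun Y hY => by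
      refine ih Y _ ?_
      have : ∑ K ∈ Y, (1 + (inducedForbidden F B K).card) <
          ∑ K ∈ X, (1 + (inducedForbidden F B K).card) := by
        obtain ⟨K, hK, hKY⟩ := Finset.exists_of_ssubset hY
        exact Finset.sum_lt_sum_of_subset hY.1 hK hKY (by omega) (by simp)
      omega
    set M := deletions X (inducedForbidden F B) with hM
    have hMlt : M.card < X.card := by
      by_contra! hge
      refine hno fun Y hY => ?_
      rcases hY.eq_or_ssubset with rfl | hs
      · exact hge
      · exact hproper Y hs
    have hmono : ∀ Y ⊆ X, deletions Y (inducedForbidden F B) ⊆ M := fun Y hY =>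
      Finset.biUnion_subset_biUnion_of_subset_left _ hY
    have hMge : X.card ≤ M.card + 1 := by
      have h1 := hproper _ (Finset.erase_ssubset hK₀)
      have h2 := Finset.card_le_card (hmono _ (Finset.erase_subset K₀ X))
      rw [Finset.card_erase_of_mem hK₀] at h1
      omega
    -- deletions of collapsing vertices are not in `M`
    have hnotM : ∀ K ∈ X, ∀ b ∈ collapsing F K, K.deleteAt b ∉ M := by
      intro K hK b hb hbM
      have hbI : b ∈ inducedForbidden F B K := Finset.mem_union_left _ hb
      -- Allowing `b` for `K` lowers the weight to `n`, so induction gives `X.card` deletions; with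
      -- `K.deleteAt b` in `M`, all would lie in `M`.
      let C : SimpleGraph (Fin (n + 1)) → Finset (Fin (n + 1)) :=
        Function.update (inducedForbidden F B) K ((inducedForbidden F B K).erase b)
      have h1 : X.card ≤ (deletions X C).card := by
        refine ih X C ?_
        have : ∑ K ∈ X, (1 + (C K).card) < ∑ K ∈ X, (1 + (inducedForbidden F B K).card) := by
          refine Finset.sum_lt_sum (fun J _ => ?_) ⟨K, hK, ?_⟩
          · by_cases hJ : J = K
            · subst hJ
              simpa [C] using Finset.card_erase_le
            · simp [C, hJ]
          · simpa [C] using Finset.card_erase_lt_of_mem hbI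
        omega
      have h2 : deletions X C ⊆ M := by
        intro S hS
        obtain ⟨J, hJ, v, hv, rfl⟩ := mem_deletions.1 hS
        by_cases hJK : J = K
        · subst hJK
          by_cases hvb : v = b
          · rwa [hvb]
          · refine mem_deletions.2 ⟨J, hJ, v, fun hmem => hv ?_, rfl⟩
            simpa [C, hvb] using hmem
        · exact mem_deletions.2 ⟨J, hJ, v, by simpa [C, hJK] using hv, rfl⟩
      exact hMlt.not_ge (h1.trans (Finset.card_le_card h2))
    set a := ∑ L ∈ M, (shadowFibre F B L).card with ha
    have hage : ∀ K ∈ X, F.card ≤ a + (lastFibre F K).card := by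
      intro K hK
      have h1 := sum_card_lastFibre_le (F := F) (B := B) (X.erase K) fun Y hY =>
        hproper Y (lt_of_le_of_lt hY (Finset.erase_ssubset hK))
      have h2 : _ ≤ a := Finset.sum_le_sum_of_subset (hmono _ (Finset.erase_subset K X))
      have h3 := Finset.sum_erase_add X (fun K => (lastFibre F K).card) hK
      omega
    have hΦ : ∀ K ∈ X, ∀ b ∈ collapsing F K,
        (lastFibre F K).card ≤ (shadowFibre F B (K.deleteAt b)).card + 1 := by
      intro K hK b hb
      have := card_collapsing_le_card_shadowFibre (hne K hK) (hcolB K hK b hb)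
      have := hcol K hK
      omega
    have hale : ∀ K ∈ X, ∀ b ∈ collapsing F K,
        a + (shadowFibre F B (K.deleteAt b)).card < F.card := by
      intro K hK b hb
      refine lt_of_le_of_lt ?_ hlt
      have := sum_card_shadowFibre_le (F := F) (B := B) (insert (K.deleteAt b) M)
      rw [Finset.sum_insert (hnotM K hK b hb)] at this
      omega
    have hex : ∀ K ∈ X, 1 < (lastFibre F K).card → (collapsing F K).Nonempty := by
      intro K hK h1
      rw [← Finset.card_pos]
      have := hcol K hK
      omega
    obtain ⟨b₀, hb₀⟩ := hex K₀ hK₀ hn₀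
    -- The shadow fibre over `K.deleteAt b` has at least `(lastFibre F K).card - 1` members but
    -- fewer than `F.card - a`, which is at most the size of any fibre.
    have hcmp : ∀ K ∈ X, 1 < (lastFibre F K).card → ∀ K' ∈ X,
        (lastFibre F K).card ≤ (lastFibre F K').card := by
      intro K hK h1 K' hK'
      obtain ⟨b, hb⟩ := hex K hK h1
      have h2 := hΦ K hK b hb
      have h3 := hale K hK b hb
      have h4 := hage K' hK'
      omega
    -- all fibres have the same size
    set N := (lastFibre F K₀).card with hN
    have hconst : ∀ K ∈ X, (lastFibre F K).card = N := by
      intro K hK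
      have h1 := hcmp K₀ hK₀ hn₀ K hK
      exact le_antisymm (hcmp K hK (by omega) K₀ hK₀) h1
    have hFN : F.card = X.card * N := by
      rw [hm, Finset.sum_congr rfl hconst, Finset.sum_const, smul_eq_mul]
    have hXM : X.card = M.card + 1 := by omega
    have haeq : a = M.card * N := by
      have h1 := hage K₀ hK₀
      have h2 := hale K₀ hK₀ b₀ hb₀
      have h3 := hΦ K₀ hK₀ b₀ hb₀
      rw [hFN, hXM, Nat.succ_mul] at h1 h2
      omega
    -- all collapsing deletions give the same graph
    have hstar : ∀ K ∈ X, ∀ b ∈ collapsing F K, K.deleteAt b = K₀.deleteAt b₀ := by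
      intro K hK b hb
      by_contra hneq
      -- Two further shadow fibres would add `2 * (N - 1) ≥ N` deletions to `a`, reaching `F.card`.
      have h1 := sum_card_shadowFibre_le (F := F) (B := B)
        (insert (K.deleteAt b) (insert (K₀.deleteAt b₀) M))
      rw [Finset.sum_insert (by simp [hneq, hnotM K hK b hb]),
        Finset.sum_insert (hnotM K₀ hK₀ b₀ hb₀)] at h1
      have h2 := hΦ K hK b hb
      have h3 := hΦ K₀ hK₀ b₀ hb₀
      rw [hconst K hK] at h2
      rw [hFN, hXM, Nat.succ_mul] at hlt
      omega
    have hΦge : ∀ L ∈ M, N ≤ (shadowFibre F B L).card := by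
      intro L hL
      obtain ⟨K, hK, u, hu, rfl⟩ := mem_deletions.1 hL
      rw [← hconst K hK]
      exact card_lastFibre_le hu
    have hΦeq : ∀ L ∈ M, N = (shadowFibre F B L).card := by
      refine (Finset.sum_eq_sum_iff_of_le hΦge).1 ?_
      rw [Finset.sum_const, smul_eq_mul, ← haeq]
    -- count the vertices that may be deleted from all members of `X`
    let U : Finset (Fin (n + 1)) := (X.biUnion (inducedForbidden F B))ᶜ
    have hUX : X.card ≤ U.card := by
      have h1 : (X.biUnion (inducedForbidden F B)).card ≤ _ := Finset.card_biUnion_le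
      rw [Finset.sum_add_distrib, Finset.sum_const, smul_eq_mul, mul_one] at heq
      have h2 : U.card = n + 1 - _ := (Finset.card_compl _).trans (by rw [Fintype.card_fin])
      omega
    have hU : ∀ p ∈ U, ∀ K ∈ X, p ∉ inducedForbidden F B K := fun p hp K hK hmem =>
      Finset.mem_compl.1 hp (Finset.mem_biUnion.2 ⟨K, hK, hmem⟩)
    refine hUX.not_gt (card_lt_card_of_differ_at_edge X ⟨K₀, hK₀⟩ U fun p hp => ?_)
    obtain ⟨K, hK, K', hK', hKK', hdel⟩ := Finset.exists_ne_map_eq_of_card_lt_of_maps_to hMlt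
      (f := fun K => K.deleteAt p)
      (fun K hK => mem_deletions.2 ⟨K, hK, p, hU p hp K hK, rfl⟩)
    have hpK := hU p hp K hK
    have hpK' := hU p hp K' hK'
    have hsubset : (Finset.univ.filter fun x : Fin n => p.succAbove x ∈ collapsing F K) ⊆
        Finset.univ.filter fun x : Fin n => p.succAbove x ∈ collapsing F K' := by
      have hL : K.deleteAt p ∈ M := mem_deletions.2 ⟨K, hK, p, hpK, rfl⟩
      -- The common shadow fibre has `N` members, so the two collapsing sets have fewer than `N`
      -- elements together; that of `K'` already has `N - 1`.
      have h1 := card_lt_card_of_lastRow_differ_at (shadowFibre F B (K.deleteAt p)) _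
        (fun _ hS => (Finset.mem_filter.1 hS).2)
        (Finset.card_pos.1 (by have := hΦeq _ hL; omega))
        ((Finset.univ.filter fun x : Fin n => p.succAbove x ∈ collapsing F K) ∪
          Finset.univ.filter fun x : Fin n => p.succAbove x ∈ collapsing F K') fun x hx => by
          rcases Finset.mem_union.1 hx with hx | hx
          · exact exists_of_succAbove_mem_collapsing
              (fun G hG => castSucc_notMem_of_notMem_inducedForbidden hpK hG) (by simpa using hx)
          · have hdel' : K.deleteAt p = K'.deleteAt p := hdel
            rw [hdel']
            exact exists_of_succAbove_mem_collapsing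
              (fun G hG => castSucc_notMem_of_notMem_inducedForbidden hpK' hG) (by simpa using hx)
      rw [← hΦeq _ hL] at h1
      have h2 := card_filter_succAbove_mem (collapsing F K') p
      rw [Finset.erase_eq_of_notMem fun hmem => hpK' (Finset.mem_union_left _ hmem)] at h2
      have h3 := hcol K' hK'
      rw [hconst K' hK'] at h3
      rw [Finset.eq_of_subset_of_card_le Finset.subset_union_right
        ((Nat.le_of_lt_succ (h3.symm ▸ h1)).trans h2.ge)]
      exact Finset.subset_union_left
    obtain ⟨c, hc⟩ := hex K hK (by rw [hconst K hK]; exact hn₀)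
    have hcp : c ≠ p := fun e => hpK (Finset.mem_union_left _ (e ▸ hc))
    have hc' : c ∈ collapsing F K' := by
      obtain ⟨x, rfl⟩ := Fin.exists_succAbove_eq hcp
      simpa using hsubset (by simpa using hc)
    refine ⟨c, fun hcU => hU c hcU K hK (Finset.mem_union_left _ hc), K, hK, K', hK', hKK',
      fun x y hxy => ?_⟩
    -- Agreement off `p` and off `c` leaves only the pair `p`, `c`.
    have hdelc : K.deleteAt c = K'.deleteAt c :=
      (hstar K hK c hc).trans (hstar K' hK' c hc').symm
    by_cases hp' : x ≠ p ∧ y ≠ p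
    · exact adj_iff_of_deleteAt_eq hdel hp'.1 hp'.2
    by_cases hc'' : x ≠ c ∧ y ≠ c
    · exact adj_iff_of_deleteAt_eq hdelc hc''.1 hc''.2
    by_cases hxy' : x = y
    · subst hxy'; simp
    exfalso
    apply hxy
    rw [Sym2.eq_iff]
    grind

end SimpleGraph

/-! ### Speeds of hereditary properties -/

open OrderedGraph SimpleGraph in
theorem OrderedGraph.IsHereditary.speed_succ_le {P : Set OrderedGraph}
    (hP : OrderedGraph.IsHereditary P) {k : ℕ} (hk : speed P k < k) :
    speed P (k + 1) ≤ speed P k := by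
  classical
  have hfin : ∀ n, (level P n).Finite := fun n => Set.toFinite _
  have key : ∀ F : Finset (SimpleGraph (Fin (k + 1))), (F : Set _) ⊆ level P (k + 1) →
      F.card ≤ k → F.card ≤ speed P k := by
    intro F hF hcard
    refine (card_le_card_deletions k F (fun _ => ∅) (by simpa using hcard)).trans ?_
    rw [← Set.ncard_coe_finset]
    refine Set.ncard_le_ncard (fun S hS => ?_) (hfin k)
    obtain ⟨G, hG, v, -, rfl⟩ := mem_deletions.1 (Finset.mem_coe.1 hS)
    exact hP (hF hG) ⟨Fin.succAboveOrderEmb v, fun _ _ => Iff.rfl⟩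
  have hcard : (hfin (k + 1)).toFinset.card = speed P (k + 1) :=
    (Set.ncard_eq_toFinset_card _ _).symm
  by_contra! hlt
  obtain ⟨F, hF, hFk⟩ := Finset.exists_subset_card_eq (s := (hfin (k + 1)).toFinset)
    (n := speed P k + 1) (by omega)
  have := key F (fun G hG => by simpa using hF hG) (by omega)
  omega

theorem theorem2 (P : Set OrderedGraph) (hP : OrderedGraph.IsHereditary P)
    (k : ℕ) (hk : 136 ≤ k) (hlt : OrderedGraph.speed P k < k) :
    (∀ n : ℕ, k ≤ n → OrderedGraph.speed P n ≤ OrderedGraph.speed P k) ∧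
      AntitoneOn (OrderedGraph.speed P) (Set.Ici k) := by
  have hsmall : ∀ n, k ≤ n → OrderedGraph.speed P n < n := by
    intro n hn
    induction n, hn using Nat.le_induction with
    | base => exact hlt
    | succ n _ ih => exact (hP.speed_succ_le ih).trans_lt (by omega)
  have hanti : ∀ m n, k ≤ m → m ≤ n → OrderedGraph.speed P n ≤ OrderedGraph.speed P m := by
    intro m n hm hmn
    induction n, hmn using Nat.le_induction with
    | base => exact le_rfl
    | succ n hmn ih => exact (hP.speed_succ_le (hsmall n (hm.trans hmn))).trans ih
  exact ⟨fun n hn => hanti k n le_rfl hn, fun m hm n _ hmn => hanti m n hm hmn⟩
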